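/- For positive integers $l$ and $m$, let $SK_{1,l}$ denote the subdivided star obtained from $l$ copies of the path $P_3$ on three vertices by identifying exactly one pendant vertex of each copy to a single vertex (the coalescence vertex), and let the double subdivided star $T_{l,m}$ be the graph obtained from the disjoint union of $SK_{1,l}$ and $SK_{1,m}$ by adding an edge between the two coalescence vertices. For a finite simple graph $G$ with adjacency matrix $A$, let $U(t)=\exp(itA)$, $t\in\mathbb{R}$; one says that $G$ exhibits perfect state transfer between two distinct vertices $a$ and $b$ if there exist $\tau\in\mathbb{R}$ and $\gamma\in\mathbb{C}$ with $U(\tau)\mathbf{e}_a=\gamma\,\mathbf{e}_b$, where $\mathbf{e}_a$ is the characteristic vector of $a$. Then, for all positive integers $l$ and $m$, there is no perfect state transfer in $T_{l,m}$ between any pair of distinct vertices. -/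

import Mathlib

/-- The vertices of the subdivided star with `l` branches: the coalescence vertex `Sum.inl ()`,
and in the `j`-th branch the middle vertex `Sum.inr (Sum.inl j)` and the pendant vertex
`Sum.inr (Sum.inr j)`. -/
abbrev SubdividedStarVertex (l : ℕ) : Type := Unit ⊕ (Fin l ⊕ Fin l)

/-- The coalescence vertex of the subdivided star. -/
abbrev coalescenceVertex (l : ℕ) : SubdividedStarVertex l := Sum.inl ()

/-- The subdivided star `SK_{1,l}`: `l` copies of the path on three vertices, glued along one end
vertex of each. The two edges of the `j`-th branch are
`coalescence vertex -- middle vertex j` and `middle vertex j -- pendant vertex j`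
(`SimpleGraph.fromRel` symmetrizes the relation). -/
def subdividedStar (l : ℕ) : SimpleGraph (SubdividedStarVertex l) :=
  SimpleGraph.fromRel fun x y =>
    match x, y with
    | Sum.inl _, Sum.inr (Sum.inl _) => True
    | Sum.inr (Sum.inl j), Sum.inr (Sum.inr k) => j = k
    | _, _ => False

/-- The double subdivided star `T_{l,m}`: the disjoint union of `SK_{1,l}` and `SK_{1,m}` together
with one more edge joining the two coalescence vertices. -/
def doubleSubdividedStar (l m : ℕ) :
    SimpleGraph (SubdividedStarVertex l ⊕ SubdividedStarVertex m) :=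
  (subdividedStar l ⊕g subdividedStar m) ⊔
    SimpleGraph.edge (Sum.inl (coalescenceVertex l)) (Sum.inr (coalescenceVertex m))

open Classical in
/-- The transition matrix `U(t) = exp(i t A)` of the continuous-time quantum walk on `G`, where `A`
is the adjacency matrix of `G`. -/
noncomputable def transitionMatrix {V : Type*} [Fintype V] [DecidableEq V] (G : SimpleGraph V)
    (t : ℝ) : Matrix V V ℂ :=
  NormedSpace.exp ((Complex.I * (t : ℂ)) • G.adjMatrix ℂ)

/-- `G` exhibits perfect state transfer between the distinct vertices `a` and `b`:
`U(τ) e_a = γ e_b` for some real `τ` and some complex `γ`. -/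
def PerfectStateTransfer {V : Type*} [Fintype V] [DecidableEq V] (G : SimpleGraph V)
    (a b : V) : Prop :=
  a ≠ b ∧ ∃ (τ : ℝ) (γ : ℂ),
    (transitionMatrix G τ).mulVec (Pi.single a 1) = γ • (Pi.single b 1 : V → ℂ)

/-!
Perfect state transfer from `a` at time `τ` pairs with an eigenvector `w` for the eigenvalue `θ` to
give `exp(iτθ) w_a = γ w_b`. In a bipartite graph, changing the sign of `w` on one colour class
gives an eigenvector for `-θ`, and comparing the squares of the two relations yields
`exp(4iτθ) = 1` as soon as `w_a ≠ 0`. Hence all such `θ²` are rational multiples of `(π / τ)²`.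

The tree `T_{l,m}` has nowhere zero eigenvectors whose eigenvalues are the square roots of the roots
of an integer cubic. The three roots of this cubic have a nonzero integer sum, so, being rational
multiples of a common number, they are rational. But the cubic is monic with constant term `-1`, and
neither `1` nor `-1` is a root of it.
-/

open Matrix Polynomial

section MatrixExponential

variable {n 𝔸 : Type*} [Fintype n] [DecidableEq n] [NormedRing 𝔸] [NormedAlgebra ℚ 𝔸]
  [CompleteSpace 𝔸]

theorem semiconjBy_matrix_exp {X M N : Matrix n n 𝔸} (h : SemiconjBy X M N) :
    SemiconjBy X (NormedSpace.exp M) (NormedSpace.exp N) :=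
  open scoped Matrix.Norms.Operator in
  have : @CompleteSpace (Matrix n n 𝔸) PseudoMetricSpace.toUniformSpace :=
    inferInstanceAs (CompleteSpace (n → n → 𝔸))
  h.exp_right

theorem vecMul_exp_eq_smul_of_vecMul_eq_smul {M : Matrix n n 𝔸} {w : n → 𝔸} {c : 𝔸}
    (h : w ᵥ* M = c • w) : w ᵥ* NormedSpace.exp M = NormedSpace.exp c • w := by
  have semiconj : SemiconjBy (replicateRow n w) M (diagonal fun _ => c) := by
    rw [SemiconjBy, ← replicateRow_vecMul, h]
    ext i j
    simp [diagonal_mul]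
  have semiconj_exp := semiconjBy_matrix_exp semiconj
  rw [SemiconjBy, exp_diagonal, ← replicateRow_vecMul] at semiconj_exp
  ext j
  simpa [diagonal_mul, Pi.coe_exp] using congrFun₂ semiconj_exp j j

end MatrixExponential

section AdjacencyMatrix

theorem vecMul_adjMatrix_coloring_smul {V R : Type*} [Fintype V] [Ring R] {G : SimpleGraph V}
    [DecidableRel G.Adj] {w : V → R} {θ : R} (s : G.Coloring ℤˣ)
    (hw : w ᵥ* G.adjMatrix R = θ • w) :
    (fun v => s v • w v) ᵥ* G.adjMatrix R = (-θ) • fun v => s v • w v := by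
  ext v
  have sign_neg (u : V) (hu : u ∈ G.neighborFinset v) : s u • w u = -(s v • w u) := by
    rw [Int.units_ne_iff_eq_neg.1 (s.valid ((G.mem_neighborFinset v u).1 hu).symm), Units.neg_smul]
  calc
    _ = -(s v • (w ᵥ* G.adjMatrix R) v) := by
      simp_rw [SimpleGraph.adjMatrix_vecMul_apply, Finset.sum_congr rfl sign_neg,
        Finset.sum_neg_distrib, Finset.smul_sum]
    _ = _ := by simp only [hw, Pi.smul_apply, smul_eq_mul, mul_smul_comm, neg_mul, smul_neg]

theorem elim_vecMul_adjMatrix_of_eq_sum_sup_edge {V W R : Type*} [Fintype V] [Fintype W]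
    [DecidableEq V] [DecidableEq W] [NonAssocSemiring R] {G : SimpleGraph V} {H : SimpleGraph W}
    {K : SimpleGraph (V ⊕ W)} [DecidableRel G.Adj] [DecidableRel H.Adj] [DecidableRel K.Adj] {a : V}
    {b : W} (hK : K = (G ⊕g H) ⊔ SimpleGraph.edge (Sum.inl a) (Sum.inr b)) (f : V → R) (g : W → R) :
    Sum.elim f g ᵥ* K.adjMatrix R =
      Sum.elim (f ᵥ* G.adjMatrix R + Pi.single a (g b))
        (g ᵥ* H.adjMatrix R + Pi.single b (f a)) := by
  ext (v | v) <;>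
    simp [hK, vecMul, dotProduct, SimpleGraph.edge_adj, Pi.single_apply, ite_and, eq_comm, add_comm]

end AdjacencyMatrix

section StateTransfer

variable {V : Type*} [Fintype V] [DecidableEq V] {G : SimpleGraph V} {a b : V} {τ : ℝ} {γ : ℂ}

theorem time_ne_zero_of_transfer (hab : a ≠ b)
    (h : transitionMatrix G τ *ᵥ Pi.single a 1 = γ • Pi.single b 1) : τ ≠ 0 := by
  rintro rfl
  simpa [transitionMatrix, hab] using congrFun h a

variable [DecidableRel G.Adj] {w : V → ℂ} {θ : ℂ}

theorem exp_mul_apply_eq_of_transfer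
    (h : transitionMatrix G τ *ᵥ Pi.single a 1 = γ • Pi.single b 1)
    (hw : w ᵥ* G.adjMatrix ℂ = θ • w) :
    Complex.exp (Complex.I * τ * θ) * w a = γ * w b := by
  have eigenvector_exp : w ᵥ* transitionMatrix G τ = Complex.exp (Complex.I * τ * θ) • w := by
    rw [Complex.exp_eq_exp_ℂ]
    apply vecMul_exp_eq_smul_of_vecMul_eq_smul
    rw [vecMul_smul, mul_smul (Complex.I * τ)]
    congr 1
    convert hw
  calc
    _ = w ᵥ* transitionMatrix G τ ⬝ᵥ Pi.single a 1 := by simp [eigenvector_exp]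
    _ = w ⬝ᵥ γ • Pi.single b 1 := by rw [← dotProduct_mulVec, h]
    _ = γ * w b := by simp

theorem exists_int_of_transfer_of_isBipartite (hG : G.IsBipartite)
    (h : transitionMatrix G τ *ᵥ Pi.single a 1 = γ • Pi.single b 1)
    (hw : w ᵥ* G.adjMatrix ℂ = θ • w) (ha : w a ≠ 0) : ∃ n : ℤ, 2 * τ * θ = n * Real.pi := by
  let s : G.Coloring ℤˣ := hG.toColoring (by simp)
  have sign_sq (v : V) : (s v • w v) ^ 2 = w v ^ 2 := by
    rcases Int.units_eq_one_or (s v) with hs | hs <;> simp [hs]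
  have exp_sq_eq : Complex.exp (Complex.I * τ * θ) ^ 2 = Complex.exp (Complex.I * τ * -θ) ^ 2 := by
    apply mul_right_cancel₀ (pow_ne_zero 2 ha)
    calc
      _ = (γ * w b) ^ 2 := by rw [← mul_pow, exp_mul_apply_eq_of_transfer h hw]
      _ = (γ * (s b • w b)) ^ 2 := by rw [mul_pow, mul_pow, sign_sq]
      _ = (Complex.exp (Complex.I * τ * -θ) * (s a • w a)) ^ 2 := by
        rw [exp_mul_apply_eq_of_transfer h (vecMul_adjMatrix_coloring_smul s hw)]
      _ = _ := by rw [mul_pow, sign_sq]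
  rw [← Complex.exp_nat_mul, ← Complex.exp_nat_mul, Complex.exp_eq_exp_iff_exists_int] at exp_sq_eq
  obtain ⟨n, hn⟩ := exp_sq_eq
  refine ⟨n, mul_left_cancel₀ Complex.I_ne_zero ?_⟩
  push_cast at hn
  linear_combination hn / 2

end StateTransfer

section PolynomialRoots

theorem mem_range_algebraMap_of_forall_root_mem_span_singleton {F K : Type*} [Field F] [Field K]
    [Algebra F K] {p : F[X]} (hp : (p.map (algebraMap F K)).Splits) (hnext : p.nextCoeff ≠ 0)
    {c : K} (hc : ∀ x, aeval x p = 0 → x ∈ Submodule.span F {c}) {x : K} (hx : aeval x p = 0) :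
    x ∈ Set.range (algebraMap F K) := by
  obtain ⟨q, hq⟩ : ∃ q : F, q • c = (p.aroots K).sum :=
    Submodule.mem_span_singleton.1 (multiset_sum_mem _ fun y hy => hc y (mem_aroots.1 hy).2)
  have nextCoeff_eq : algebraMap F K p.nextCoeff = algebraMap F K (-p.leadingCoeff * q) * c := by
    rw [← nextCoeff_map_eq, hp.nextCoeff_eq_neg_sum_roots_mul_leadingCoeff, leadingCoeff_map,
      ← aroots_def, ← hq, Algebra.smul_def, map_mul, map_neg, mul_assoc]
  have coeff_ne_zero : -p.leadingCoeff * q ≠ 0 := by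
    intro h
    rw [h, map_zero, zero_mul, map_eq_zero] at nextCoeff_eq
    exact hnext nextCoeff_eq
  obtain ⟨r, rfl⟩ := Submodule.mem_span_singleton.1 (hc x hx)
  refine ⟨r * (p.nextCoeff / (-p.leadingCoeff * q)), ?_⟩
  rw [map_mul, map_div₀, nextCoeff_eq,
    mul_div_cancel_left₀ c ((_root_.map_ne_zero _).2 coeff_ne_zero), Algebra.smul_def]

theorem eq_one_or_neg_one_of_aeval_eq_zero {p : ℤ[X]} (hp : p.Monic) (h0 : IsUnit (p.coeff 0))
    {q : ℚ} (hq : aeval q p = 0) : q = 1 ∨ q = -1 := by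
  obtain ⟨k, rfl, hk⟩ := exists_integer_of_is_root_of_monic hp hq
  rcases Int.isUnit_iff.1 (isUnit_of_dvd_unit hk h0) with rfl | rfl <;> simp

end PolynomialRoots

section QuotientCubic

/-- The cubic whose roots are the squares of the eigenvalues of the quotient of `T_{l,m}` by its
equitable partition into coalescence, middle and pendant vertices of either side. -/
def quotientCubic (l m : ℕ) : Cubic ℤ :=
  ⟨1, -(l + m + 3), (l + 1) * (m + 1) + 2, -1⟩

variable {l m : ℕ}

theorem monic_quotientCubic : (quotientCubic l m).toPoly.Monic :=
  Cubic.monic_of_a_eq_one rfl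

theorem natDegree_quotientCubic : (quotientCubic l m).toPoly.natDegree = 3 :=
  Cubic.natDegree_of_a_ne_zero one_ne_zero

theorem nextCoeff_quotientCubic : (quotientCubic l m).toPoly.nextCoeff = -(l + m + 3) := by
  rw [nextCoeff_of_natDegree_pos (by simp [natDegree_quotientCubic]), natDegree_quotientCubic]
  exact Cubic.coeff_eq_b

theorem aeval_quotientCubic {R : Type*} [CommRing R] (x : R) :
    aeval x (quotientCubic l m).toPoly = x * (x - 1 - l) * (x - 1 - m) - (x - 1) ^ 2 := by
  suffices x ^ 3 - (l + m + 3) * x ^ 2 + ((l + 1) * (m + 1) + 2) * x - 1 =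
      x * (x - 1 - l) * (x - 1 - m) - (x - 1) ^ 2 by
    simp only [Cubic.toPoly, quotientCubic, map_add, map_mul, map_pow, map_neg, map_one,
      map_natCast, map_ofNat, aeval_X]
    linear_combination this
  ring

theorem aeval_quotientCubic_one_ne_zero {R : Type*} [CommRing R] [CharZero R] [NoZeroDivisors R]
    (hl : 0 < l) (hm : 0 < m) : aeval (1 : R) (quotientCubic l m).toPoly ≠ 0 := by
  simp [aeval_quotientCubic, hl.ne', hm.ne']

theorem aeval_quotientCubic_rat_ne_zero (hl : 0 < l) (hm : 0 < m) (q : ℚ) :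
    aeval q (quotientCubic l m).toPoly ≠ 0 := by
  intro hq
  have isUnit_coeff_zero : IsUnit ((quotientCubic l m).toPoly.coeff 0) := by
    simp [quotientCubic]
  rcases eq_one_or_neg_one_of_aeval_eq_zero monic_quotientCubic isUnit_coeff_zero hq with
    rfl | rfl
  · exact aeval_quotientCubic_one_ne_zero hl hm hq
  · have value_neg : (-1 : ℚ) * (-1 - 1 - l) * (-1 - 1 - m) - (-1 - 1) ^ 2 < 0 := by
      have : (0 : ℚ) ≤ l * m := by positivity
      linarith
    exact value_neg.ne ((aeval_quotientCubic _).symm.trans hq)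

end QuotientCubic

section DoubleSubdividedStar

variable {l m : ℕ}

theorem isBipartite_doubleSubdividedStar : (doubleSubdividedStar l m).IsBipartite := by
  let color : SubdividedStarVertex l ⊕ SubdividedStarVertex m → Fin 2
    | Sum.inl (Sum.inr (Sum.inl _)) | Sum.inr (Sum.inl _) | Sum.inr (Sum.inr (Sum.inr _)) => 0
    | _ => 1
  refine ⟨SimpleGraph.Coloring.mk color ?_⟩
  rintro ((_ | _ | _) | (_ | _ | _)) ((_ | _ | _) | (_ | _ | _)) <;>
    simp [doubleSubdividedStar, subdividedStar, SimpleGraph.edge_adj, color]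

theorem vecMul_adjMatrix_subdividedStar {R : Type*} [NonAssocSemiring R]
    [DecidableRel (subdividedStar l).Adj] (f : SubdividedStarVertex l → R) :
    f ᵥ* (subdividedStar l).adjMatrix R =
      Sum.elim (fun _ => ∑ j, f (Sum.inr (Sum.inl j)))
        (Sum.elim (fun j => f (coalescenceVertex l) + f (Sum.inr (Sum.inr j)))
          fun j => f (Sum.inr (Sum.inl j))) := by
  ext (_ | _ | _) <;>
    simp only [vecMul, dotProduct, Fintype.sum_sum_type, SimpleGraph.adjMatrix_apply] <;>
    simp [subdividedStar]

/-- The function on the vertices of a subdivided star with value `α` at the pendant vertices which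
satisfies the eigenvector equation for `θ` at the pendant and the middle vertices. -/
def branchVector {R : Type*} [CommRing R] (l : ℕ) (θ α : R) : SubdividedStarVertex l → R :=
  Sum.elim (fun _ => (θ ^ 2 - 1) * α) (Sum.elim (fun _ => θ * α) fun _ => α)

theorem branchVector_vecMul_adjMatrix {R : Type*} [CommRing R]
    [DecidableRel (subdividedStar l).Adj] (θ α : R) :
    branchVector l θ α ᵥ* (subdividedStar l).adjMatrix R =
      θ • branchVector l θ α -
        Pi.single (coalescenceVertex l) (θ * (θ ^ 2 - 1 - l) * α : R) := by
  rw [vecMul_adjMatrix_subdividedStar]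
  ext (_ | _ | _) <;> simp [branchVector] <;> ring

theorem elim_branchVector_vecMul_adjMatrix {R : Type*} [CommRing R]
    [DecidableRel (doubleSubdividedStar l m).Adj] {θ α β : R}
    (hα : θ * (θ ^ 2 - 1 - l) * α = (θ ^ 2 - 1) * β)
    (hβ : θ * (θ ^ 2 - 1 - m) * β = (θ ^ 2 - 1) * α) :
    Sum.elim (branchVector l θ α) (branchVector m θ β) ᵥ* (doubleSubdividedStar l m).adjMatrix R =
      θ • Sum.elim (branchVector l θ α) (branchVector m θ β) := by
  classical
  rw [elim_vecMul_adjMatrix_of_eq_sum_sup_edge (doubleSubdividedStar.eq_def l m),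
    branchVector_vecMul_adjMatrix, branchVector_vecMul_adjMatrix, hα, hβ]
  ext (v | v) <;> simp [branchVector]

theorem exists_nowhere_zero_eigenvector {K : Type*} [Field K] [CharZero K]
    [DecidableRel (doubleSubdividedStar l m).Adj] (hl : 0 < l) (hm : 0 < m) {θ : K}
    (hθ : aeval (θ ^ 2) (quotientCubic l m).toPoly = 0) :
    ∃ w, w ᵥ* (doubleSubdividedStar l m).adjMatrix K = θ • w ∧ ∀ v, w v ≠ 0 := by
  have sub_one_ne_zero : θ ^ 2 - 1 ≠ 0 := fun h =>
    aeval_quotientCubic_one_ne_zero hl hm (sub_eq_zero.1 h ▸ hθ)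
  rw [aeval_quotientCubic, sub_eq_zero] at hθ
  obtain ⟨⟨sq_ne_zero, sub_ne_zero⟩, -⟩ : (θ ^ 2 ≠ 0 ∧ θ ^ 2 - 1 - l ≠ 0) ∧ θ ^ 2 - 1 - m ≠ 0 := by
    simpa only [← mul_ne_zero_iff, hθ] using pow_ne_zero 2 sub_one_ne_zero
  have θ_ne_zero : θ ≠ 0 := ne_zero_pow two_ne_zero sq_ne_zero
  refine ⟨Sum.elim (branchVector l θ (θ ^ 2 - 1)) (branchVector m θ (θ * (θ ^ 2 - 1 - l))),
    elim_branchVector_vecMul_adjMatrix (by ring) (by linear_combination hθ), ?_⟩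
  rintro ((_ | _ | _) | (_ | _ | _)) <;> simp [branchVector, *]

theorem root_mem_span_of_transfer (hl : 0 < l) (hm : 0 < m)
    {a b : SubdividedStarVertex l ⊕ SubdividedStarVertex m} {τ : ℝ} (hτ : τ ≠ 0) {γ : ℂ}
    (h : transitionMatrix (doubleSubdividedStar l m) τ *ᵥ Pi.single a 1 = γ • Pi.single b 1)
    {x : ℂ} (hx : aeval x (quotientCubic l m).toPoly = 0) :
    x ∈ Submodule.span ℚ {(Real.pi / τ : ℂ) ^ 2} := by
  classical
  obtain ⟨θ, rfl⟩ := IsAlgClosed.exists_pow_nat_eq x two_pos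
  obtain ⟨w, hw, w_ne_zero⟩ := exists_nowhere_zero_eigenvector hl hm hx
  obtain ⟨n, hn⟩ :=
    exists_int_of_transfer_of_isBipartite isBipartite_doubleSubdividedStar h hw (w_ne_zero a)
  have θ_eq : θ = n / 2 * (Real.pi / τ) := by
    have : (τ : ℂ) ≠ 0 := by exact_mod_cast hτ
    field_simp
    linear_combination hn
  refine Submodule.mem_span_singleton.2 ⟨(n / 2) ^ 2, ?_⟩
  rw [θ_eq, mul_pow, Rat.smul_def]
  push_cast
  rfl

theorem theorem3p1_general (l m : ℕ) (hl : 0 < l) (hm : 0 < m)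
    (a b : SubdividedStarVertex l ⊕ SubdividedStarVertex m) {τ : ℝ} (hτ : τ ≠ 0) (γ : ℂ) :
    transitionMatrix (doubleSubdividedStar l m) τ *ᵥ Pi.single a 1 ≠ γ • Pi.single b 1 := by
  intro h
  let p : ℚ[X] := (quotientCubic l m).toPoly.map (algebraMap ℤ ℚ)
  have nextCoeff_ne_zero : p.nextCoeff ≠ 0 := by
    rw [nextCoeff_map (algebraMap ℤ ℚ).injective_int, nextCoeff_quotientCubic]
    exact (map_ne_zero_iff _ (algebraMap ℤ ℚ).injective_int).2 (by lia)
  obtain ⟨x, hx⟩ : ∃ x : ℂ, aeval x (quotientCubic l m).toPoly = 0 :=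
    IsAlgClosed.exists_aeval_eq_zero ℂ _
      (degree_ne_of_natDegree_ne (by simp [natDegree_quotientCubic]))
  obtain ⟨q, rfl⟩ : x ∈ Set.range (algebraMap ℚ ℂ) := by
    refine mem_range_algebraMap_of_forall_root_mem_span_singleton (p := p) (IsAlgClosed.splits _)
      nextCoeff_ne_zero (fun y hy => root_mem_span_of_transfer hl hm hτ h ?_) ?_
    · rwa [aeval_map_algebraMap] at hy
    · rwa [aeval_map_algebraMap]
  rw [aeval_algebraMap_apply, map_eq_zero] at hx
  exact aeval_quotientCubic_rat_ne_zero hl hm q hx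

end DoubleSubdividedStar

theorem theorem3p1 (l m : ℕ) (hl : 0 < l) (hm : 0 < m)
    (a b : SubdividedStarVertex l ⊕ SubdividedStarVertex m) :
    ¬ PerfectStateTransfer (doubleSubdividedStar l m) a b := by
  rintro ⟨hab, τ, γ, h⟩
  exact theorem3p1_general l m hl hm a b (time_ne_zero_of_transfer hab h) γ h
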